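/- Let $\Omega\subset\mathbb R^2$ be a bounded domain (open, connected) with $C^\infty$ boundary, lying locally on one side of its boundary, such that $\{0\}\times[-1,1]\subset\partial\Omega$ and $\Omega\cap\{x\ge 0\}=\emptyset$. Let $g\in C^2[0,1]$ be positive and satisfy (MP) at $0$: there is $\delta\in(0,1/2)$ such that $g$ is (not necessarily strictly) decreasing on $[0,\delta)$. For $\epsilon>0$ put $$R_\epsilon=\{(x,y): 0<x<1,\ 0<y<\epsilon g(x)\},\qquad L_\epsilon=\{0\}\times(0,\epsilon g(0)),\qquad \Omega_\epsilon=\Omega\cup R_\epsilon\cup L_\epsilon ,$$ and, for $\theta>0$, $$J_\epsilon^\theta=\{(x,y)\in R_\epsilon: 0<x<\epsilon^\theta\}.$$ Let $R$ be a real number, let $\epsilon_0>0$, and for every $\epsilon\in(0,\epsilon_0)$ let $u_\epsilon\in H^2(\Omega_\epsilon)$ be a real-valued function with $\|u_\epsilon\|_{H^2(\Omega_\epsilon)}\le R$, where $$\|u\|_{H^2(U)}^2=\|u\|_{L^2(U)}^2+\|\nabla u\|_{L^2(U)}^2+\|D^2u\|_{L^2(U)}^2 .$$ Then, for every $\theta$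 with $0<\theta<\tfrac13$, $$\|u_\epsilon\|_{L^2(J_\epsilon^\theta)}=O(\epsilon^{2\theta})\qquad\text{and}\qquad \|\nabla u_\epsilon\|_{L^2(J_\epsilon^\theta)}=O(\epsilon^{\theta})\qquad\text{as }\epsilon\to0^+ .$$ -/

import Mathlib

open MeasureTheory Set Filter Asymptotics
open scoped Topology ContDiff

noncomputable section

namespace ThinChannel

/-- The standard unit vectors `(1, 0)` and `(0, 1)` of the plane. -/
def dir : Fin 2 → ℝ × ℝ := ![(1, 0), (0, 1)]

/-- `v` is a weak partial derivative of `u` in the `i`-th coordinate direction on the open set `U`: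
both are locally integrable on `U`, and `∫_U u ∂ᵢφ = - ∫_U v φ` for every `φ ∈ C_c^∞(U)`. -/
def HasWeakPartial (U : Set (ℝ × ℝ)) (i : Fin 2) (u v : ℝ × ℝ → ℝ) : Prop :=
  LocallyIntegrableOn u U ∧ LocallyIntegrableOn v U ∧
    ∀ φ : ℝ × ℝ → ℝ, ContDiff ℝ ∞ φ → HasCompactSupport φ → tsupport φ ⊆ U →
      ∫ z in U, u z * fderiv ℝ φ z (dir i) = - ∫ z in U, v z * φ z

/-- Weak partial derivatives on an open set are unique up to a null set. -/
theorem HasWeakPartial.ae_unique {U : Set (ℝ × ℝ)} (hU : IsOpen U) {i : Fin 2}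
    {u v w : ℝ × ℝ → ℝ} (hv : HasWeakPartial U i u v) (hw : HasWeakPartial U i u w) :
    v =ᵐ[volume.restrict U] w := by
  have key : ∀ᵐ z ∂(volume : Measure (ℝ × ℝ)), z ∈ U → v z - w z = 0 := by
    refine hU.ae_eq_zero_of_integral_contDiff_smul_eq_zero (hv.2.1.sub hw.2.1) ?_
    intro φ hφ hc hs
    have h1 := hv.2.2 φ hφ hc hs
    have h2 := hw.2.2 φ hφ hc hs
    have hint : ∀ f : ℝ × ℝ → ℝ, LocallyIntegrableOn f U →
        IntegrableOn (fun z => f z * φ z) U := by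
      intro f hf
      have hK : IntegrableOn f (tsupport φ) := hf.integrableOn_compact_subset hs hc
      have h3 : IntegrableOn (fun z => f z * φ z) (tsupport φ) :=
        hK.mul_continuousOn hφ.continuous.continuousOn hc
      have h4 : Integrable (fun z => f z * φ z) := by
        refine (integrableOn_iff_integrable_of_support_subset ?_).1 h3
        intro z hz
        refine subset_tsupport φ ?_
        intro h0
        exact hz (by simp [h0])
      exact h4.integrableOn
    have h5 : ∫ z in U, (v z * φ z - w z * φ z) = 0 := by
      rw [integral_sub (hint v hv.2.1) (hint w hw.2.1)]
      linarith
    have h6 : ∫ z, φ z • (v z - w z) = ∫ z in U, φ z • (v z - w z) := by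
      refine (setIntegral_eq_integral_of_forall_compl_eq_zero ?_).symm
      intro z hz
      have : φ z = 0 := by
        by_contra h0
        exact hz (hs (subset_tsupport φ h0))
      simp [this]
    change ∫ z, φ z • (v z - w z) = 0
    rw [h6, ← h5]
    congr 1
    funext z
    simp only [smul_eq_mul]
    ring
  refine (ae_restrict_iff' hU.measurableSet).2 ?_
  filter_upwards [key] with z hz hzU
  exact sub_eq_zero.1 (hz hzU)

open Classical in
/-- The weak partial derivative `∂ᵢu` on `U` (a representative of its a.e. class; it is `0` by
convention if `u` has no weak partial derivative). -/
def weakPartial (U : Set (ℝ × ℝ)) (i : Fin 2) (u : ℝ × ℝ → ℝ) : ℝ × ℝ → ℝ :=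
  if h : ∃ v, HasWeakPartial U i u v then h.choose else 0

theorem hasWeakPartial_weakPartial {U : Set (ℝ × ℝ)} {i : Fin 2} {u v : ℝ × ℝ → ℝ}
    (h : HasWeakPartial U i u v) : HasWeakPartial U i u (weakPartial U i u) := by
  have h' : ∃ v, HasWeakPartial U i u v := ⟨v, h⟩
  rw [weakPartial, dif_pos h']
  exact h'.choose_spec

/-- `u ∈ H²(U)`: `u` lies in `L²(U)` and has weak partial derivatives of first and second order,
all of which lie in `L²(U)`. -/
def MemH2 (U : Set (ℝ × ℝ)) (u : ℝ × ℝ → ℝ) : Prop :=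
  MemLp u 2 (volume.restrict U) ∧
    ∀ i, ∃ v, HasWeakPartial U i u v ∧ MemLp v 2 (volume.restrict U) ∧
      ∀ j, ∃ w, HasWeakPartial U j v w ∧ MemLp w 2 (volume.restrict U)

/-- The norm `‖f‖_{L²(S)}` (for `f ∈ L²(S)`). -/
def l2Norm (S : Set (ℝ × ℝ)) (f : ℝ × ℝ → ℝ) : ℝ :=
  (eLpNorm f 2 (volume.restrict S)).toReal

/-- `‖∇u‖_{L²(S)}` for `S ⊆ U`, where `∇u` is the weak gradient of `u` on `U`. -/
def gradL2Norm (U S : Set (ℝ × ℝ)) (u : ℝ × ℝ → ℝ) : ℝ :=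
  Real.sqrt (∑ i, l2Norm S (weakPartial U i u) ^ 2)

/-- `‖u‖_{H²(U)}`, with
`‖u‖²_{H²(U)} = ‖u‖²_{L²(U)} + ‖∇u‖²_{L²(U)} + ‖D²u‖²_{L²(U)}`. -/
def h2Norm (U : Set (ℝ × ℝ)) (u : ℝ × ℝ → ℝ) : ℝ :=
  Real.sqrt (l2Norm U u ^ 2 + ∑ i, l2Norm U (weakPartial U i u) ^ 2 +
    ∑ i, ∑ j, l2Norm U (weakPartial U j (weakPartial U i u)) ^ 2)

/-- The boundary of `U` is smooth: near each boundary point, `U` is the sublevel set `{ρ < 0}` of a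
smooth function `ρ` without critical points. In particular `U` lies locally on one side of its
boundary. -/
def HasSmoothBoundary (U : Set (ℝ × ℝ)) : Prop :=
  ∀ p ∈ frontier U, ∃ V : Set (ℝ × ℝ), IsOpen V ∧ p ∈ V ∧
    ∃ ρ : ℝ × ℝ → ℝ, ContDiffOn ℝ ∞ ρ V ∧ (∀ z ∈ V, fderiv ℝ ρ z ≠ 0) ∧
      U ∩ V = {z ∈ V | ρ z < 0}

/-- `U` is a bounded smooth domain of the plane. -/
structure IsSmoothBoundedDomain (U : Set (ℝ × ℝ)) : Prop where
  isOpen : IsOpen U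
  isConnected : IsConnected U
  isBounded : Bornology.IsBounded U
  smooth : HasSmoothBoundary U

/-- The channel `R_ε = {(x, y) : 0 < x < 1, 0 < y < ε g(x)}`. -/
def channel (g : ℝ → ℝ) (ε : ℝ) : Set (ℝ × ℝ) :=
  {z | 0 < z.1 ∧ z.1 < 1 ∧ 0 < z.2 ∧ z.2 < ε * g z.1}

/-- The junction `L_ε = {0} × (0, ε g(0))`. -/
def junction (g : ℝ → ℝ) (ε : ℝ) : Set (ℝ × ℝ) :=
  {z | z.1 = 0 ∧ 0 < z.2 ∧ z.2 < ε * g 0}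

/-- The one-sided dumbbell `Ω_ε = Ω ∪ R_ε ∪ L_ε`. -/
def dumbbell (Ω : Set (ℝ × ℝ)) (g : ℝ → ℝ) (ε : ℝ) : Set (ℝ × ℝ) :=
  Ω ∪ channel g ε ∪ junction g ε

/-- The part `J_ε^θ = {(x, y) ∈ R_ε : 0 < x < ε^θ}` of the channel near the junction. -/
def channelEnd (g : ℝ → ℝ) (θ ε : ℝ) : Set (ℝ × ℝ) :=
  {z ∈ channel g ε | 0 < z.1 ∧ z.1 < ε ^ θ}

/-- Condition (MP) at the end `x = 0` of the channel: `g` is (not necessarily strictly) decreasing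
on `[0, δ)` for some `δ ∈ (0, 1/2)`. -/
def ConditionMP (g : ℝ → ℝ) : Prop :=
  ∃ δ : ℝ, 0 < δ ∧ δ < 1 / 2 ∧ AntitoneOn g (Ico 0 δ)

end ThinChannel

end

noncomputable section

namespace ThinChannel

/-! Write `a = ε ^ θ` and `b = ε * g 0`. Since `∂Ω` contains a vertical segment through the origin
and `Ω` lies to its left, `Ω` contains a rectangle `(-η, 0) × (-η, η)` (`exists_rectangle_subset`),
so for small `ε` the channel can be prolonged to the left inside the dumbbell with constant height
`b`. By (MP) the prolonged profile is decreasing up to `δ`; hence moving a point of the channel end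
left by `a` keeps it in the dumbbell and brings it into the corner `(-a, 0) × (0, b)` of `Ω`.
Integrating the weak `x`-derivative along this segment gives, for `f = u` and `f = ∂ᵢu`, `‖f‖²_J ≤ 2
‖f‖²_corner + 2 a² ‖∂ₓf‖²_neck` (`HasWeakPartial.l2Norm_channelEnd_sq_le`).

The corner terms are small because a set of extent `d` in one direction carries only a fraction of
order `d` of the squared norms of a function and its derivative in that direction
(`HasWeakPartial.mul_l2Norm_sq_le`). Thinness in `y` gives `O(b)` for both `u` and `∂ᵢu`; shortness
in `x` gives a further factor `a` for `u`, whose `x`-derivative is already known to be `O(b)` on the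
strip. As `θ < 1/3`, `b = O(a³)`. For `∂ᵢu` this gives `O(a³) + O(a²)`, the second term from the
bounded second derivatives. This makes `‖∂ₓu‖²_neck = O(a²)`, which, put back into the inequality
for `u`, gives `O(a⁴) + a² O(a²) = O(a⁴)`. -/

/-- `∫_S f²`, as an extended nonnegative real. -/
def energy (S : Set (ℝ × ℝ)) (f : ℝ × ℝ → ℝ) : ENNReal := ∫⁻ z in S, ‖f z‖ₑ ^ 2

/-! ### Weak derivatives and translations -/

/-- `v` is the distributional derivative of `f` along the vector `e`, tested on `U`. -/
def IsWeakDirDeriv (U : Set (ℝ × ℝ)) (e : ℝ × ℝ) (f v : ℝ × ℝ → ℝ) : Prop :=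
  ∀ φ : ℝ × ℝ → ℝ, ContDiff ℝ ∞ φ → HasCompactSupport φ → tsupport φ ⊆ U →
    ∫ z, f z * fderiv ℝ φ z e = - ∫ z, v z * φ z

theorem quasiMeasurePreserving_add_smul (e : ℝ × ℝ) (μ : Measure ℝ) [SFinite μ] :
    Measure.QuasiMeasurePreserving (fun p : ℝ × (ℝ × ℝ) => p.2 + p.1 • e)
      (μ.prod volume) volume := by
  refine ⟨by fun_prop, Measure.AbsolutelyContinuous.mk fun s hs h0 => ?_⟩
  have hm : Measurable (fun p : ℝ × (ℝ × ℝ) => p.2 + p.1 • e) := by fun_prop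
  rw [Measure.map_apply hm hs]
  rw [Measure.measure_prod_null (hm hs)]
  refine Eventually.of_forall fun r => ?_
  change volume ((fun z => z + r • e) ⁻¹' s) = 0
  rw [measure_preimage_add_right, h0]

/-- The fundamental theorem of calculus for a weak derivative, by duality: against a test function
`φ` supported in `A`, the translation is moved onto `φ`, where the classical theorem applies. The
segment hypothesis makes every translate `φ (· - r • e)` admissible in `U`, so the derivative can be
moved back and Fubini finishes. -/
theorem ae_translate_sub_eq_integral {U A : Set (ℝ × ℝ)} (hA : IsOpen A) {e : ℝ × ℝ} {τ : ℝ}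
    (hτ : 0 ≤ τ) {f v : ℝ × ℝ → ℝ} (hf : Integrable f) (hv : Integrable v)
    (h : IsWeakDirDeriv U e f v) (hseg : ∀ z ∈ A, ∀ r ∈ Icc 0 τ, z + r • e ∈ U) :
    ∀ᵐ z, z ∈ A → f (z + τ • e) - f z = ∫ r in Ioc 0 τ, v (z + r • e) := by
  set μ := (volume : Measure ℝ).restrict (Ioc 0 τ) with hμ
  have hshear : MeasurePreserving (fun p : ℝ × (ℝ × ℝ) => (p.1, p.2 + p.1 • e))
      (μ.prod volume) (μ.prod volume) := by
    refine MeasurePreserving.skew_product (g := fun r z => z + r • e)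
      (MeasurePreserving.id μ) (by fun_prop) ?_
    exact Eventually.of_forall fun r => (measurePreserving_add_right volume (r • e)).map_eq
  have hsnd : ∀ k : ℝ × ℝ → ℝ, Integrable k →
      Integrable (fun p : ℝ × (ℝ × ℝ) => k p.2) (μ.prod volume) := fun k hk => hk.comp_snd μ
  have hvs : Integrable (fun p : ℝ × (ℝ × ℝ) => v (p.2 + p.1 • e)) (μ.prod volume) :=
    hshear.integrable_comp_of_integrable (hsnd v hv)
  have hV : Integrable (fun z => ∫ r, v (z + r • e) ∂μ) := hvs.integral_prod_right
  have hft : Integrable (fun z => f (z + τ • e)) := hf.comp_add_right _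
  have key : ∀ᵐ z, z ∈ A → f (z + τ • e) - f z - ∫ r, v (z + r • e) ∂μ = 0 := by
    refine hA.ae_eq_zero_of_integral_contDiff_smul_eq_zero
      (((hft.sub hf).sub hV).locallyIntegrable.locallyIntegrableOn A) ?_
    intro φ hφ hc hs
    have hb : ∃ C, ∀ z, ‖φ z‖ ≤ C := hc.exists_bound_of_continuous hφ.continuous
    obtain ⟨C, hC⟩ := hb
    have hdc : Continuous (fun z => fderiv ℝ φ z e) :=
      (hφ.continuous_fderiv (by simp)).clm_apply continuous_const
    have hdcs : HasCompactSupport (fun z => fderiv ℝ φ z e) := hc.fderiv_apply ℝ e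
    obtain ⟨D, hD⟩ := hdcs.exists_bound_of_continuous hdc
    have hmul : ∀ k : ℝ × ℝ → ℝ, Integrable k → Integrable (fun z => φ z * k z) :=
      fun k hk => hk.bdd_mul hφ.continuous.aestronglyMeasurable (Eventually.of_forall hC)
    -- each translate of `φ` is an admissible test function
    have htest : ∀ r ∈ Icc 0 τ, ∫ z, f z * fderiv ℝ φ (z - r • e) e
        = - ∫ z, v z * φ (z - r • e) := by
      intro r hr
      have h1 := h (fun z => φ (z - r • e)) (hφ.comp (contDiff_id.sub contDiff_const))
        (hc.comp_homeomorph (Homeomorph.subRight (r • e))) ?_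
      · simpa only [fderiv_comp_sub] using h1
      · intro z hz
        have h2 : z - r • e ∈ tsupport φ := by
          have := tsupport_comp_subset_preimage φ (f := fun z => z - r • e) (by fun_prop) hz
          exact this
        simpa using hseg _ (hs h2) r hr
    have hFTC : ∀ z, φ (z - τ • e) - φ z = - ∫ r, fderiv ℝ φ (z - r • e) e ∂μ := by
      intro z
      have hder : ∀ r ∈ uIcc 0 τ, HasDerivAt (fun r : ℝ => φ (z - r • e))
          (- fderiv ℝ φ (z - r • e) e) r := by
        intro r _
        have h1 : HasDerivAt (fun r : ℝ => z - r • e) (-e) r := by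
          simpa using ((hasDerivAt_id r).smul_const e).const_sub z
        have h2 := ((hφ.differentiable (by simp)) (z - r • e)).hasFDerivAt.comp_hasDerivAt r h1
        simpa [Function.comp_def] using h2
      have := intervalIntegral.integral_eq_sub_of_hasDerivAt hder
        (Continuous.intervalIntegrable (by
          exact (hdc.comp (by fun_prop : Continuous fun r : ℝ => z - r • e)).neg) _ _)
      rw [intervalIntegral.integral_of_le hτ, integral_neg] at this
      simpa using this.symm
    have e1 : ∫ z, φ z * f (z + τ • e) = ∫ z, f z * φ (z - τ • e) := by
      rw [← integral_add_right_eq_self (fun z => f z * φ (z - τ • e)) (τ • e)]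
      simp [mul_comm]
    have i1 : Integrable (fun z => f z * φ (z - τ • e)) :=
      hf.mul_bdd (hφ.continuous.comp (by fun_prop)).aestronglyMeasurable
        (Eventually.of_forall fun z => hC _)
    have i2 : Integrable (fun z => f z * φ z) :=
      hf.mul_bdd hφ.continuous.aestronglyMeasurable (Eventually.of_forall hC)
    have i3 : Integrable (fun p : ℝ × (ℝ × ℝ) => f p.2 * fderiv ℝ φ (p.2 - p.1 • e) e)
        (μ.prod volume) :=
      (hsnd f hf).mul_bdd (hdc.comp (by fun_prop)).aestronglyMeasurable
        (Eventually.of_forall fun z => hD _)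
    have i4 : Integrable (fun p : ℝ × (ℝ × ℝ) => φ p.2 * v (p.2 + p.1 • e)) (μ.prod volume) :=
      hvs.bdd_mul (hφ.continuous.comp continuous_snd).aestronglyMeasurable
        (Eventually.of_forall fun z => hC _)
    have e2 : ∫ z, f z * φ (z - τ • e) - f z * φ z = ∫ z, φ z * ∫ r, v (z + r • e) ∂μ := by
      calc ∫ z, f z * φ (z - τ • e) - f z * φ z
          = ∫ z, -∫ r, f z * fderiv ℝ φ (z - r • e) e ∂μ := by
            congr 1; funext z
            rw [← mul_sub, hFTC, integral_const_mul]; ring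
        _ = -∫ r, ∫ z, f z * fderiv ℝ φ (z - r • e) e ∂volume ∂μ := by
            rw [integral_neg, integral_integral_swap (f := fun z r => f z * fderiv ℝ φ (z - r • e) e) i3.swap]
        _ = ∫ r, ∫ z, φ z * v (z + r • e) ∂volume ∂μ := by
            rw [← integral_neg]
            refine setIntegral_congr_fun measurableSet_Ioc fun r hr => ?_
            change -∫ z, f z * fderiv ℝ φ (z - r • e) e = ∫ z, φ z * v (z + r • e)
            rw [htest r (Ioc_subset_Icc_self hr), neg_neg,
              ← integral_add_right_eq_self (fun z => v z * φ (z - r • e)) (r • e)]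
            simp [mul_comm]
        _ = ∫ z, φ z * ∫ r, v (z + r • e) ∂μ := by
            rw [integral_integral_swap (f := fun r z => φ z * v (z + r • e)) i4]
            simp_rw [integral_const_mul]
    change ∫ z, φ z * (f (z + τ • e) - f z - ∫ r, v (z + r • e) ∂μ) = 0
    have : ∀ z, φ z * (f (z + τ • e) - f z - ∫ r, v (z + r • e) ∂μ)
        = φ z * f (z + τ • e) - f z * φ z - φ z * ∫ r, v (z + r • e) ∂μ := fun z => by ring
    simp_rw [this]
    rw [integral_sub (f := fun z => φ z * f (z + τ • e) - f z * φ z) ((hmul _ hft).sub i2)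
      (hmul _ hV), integral_sub (hmul _ hft) i2, e1,
      ← integral_sub i1 i2, e2, sub_self]
  filter_upwards [key] with z hz hzA
  exact sub_eq_zero.1 (hz hzA)

/-- Averaging over translates of `A` along `e`: each point is hit by translates of total length at
most `d`. -/
theorem lintegral_lintegral_translate_le {U A : Set (ℝ × ℝ)} (hU : MeasurableSet U)
    (hA : MeasurableSet A) {e : ℝ × ℝ} {τ : ℝ} {d : ENNReal} {F : ℝ × ℝ → ENNReal}
    (hF : AEMeasurable F) (hseg : ∀ z ∈ A, ∀ r ∈ Icc 0 τ, z + r • e ∈ U)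
    (hd : ∀ w : ℝ × ℝ, volume {r ∈ Ioc 0 τ | w - r • e ∈ A} ≤ d) :
    ∫⁻ r in Ioc 0 τ, ∫⁻ z in A, F (z + r • e) ≤ d * ∫⁻ z in U, F z := by
  -- Substituting `w = z + r • e` frees `F` from `r`; after Tonelli the `r`-integral only measures
  -- how long translates of `A` cover `w`.
  have hAe : ∀ r : ℝ, ∫⁻ z in A, F (z + r • e)
      = ∫⁻ w, A.indicator 1 (w - r • e) * F w := by
    intro r
    rw [← lintegral_add_right_eq_self (fun w => A.indicator 1 (w - r • e) * F w) (r • e),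
      ← lintegral_indicator hA]
    congr 1; funext z
    by_cases hz : z ∈ A <;> simp [hz]
  have hmeas : Measurable (fun p : ℝ × (ℝ × ℝ) =>
      A.indicator (1 : ℝ × ℝ → ENNReal) (p.2 - p.1 • e)) :=
    (measurable_one.indicator hA).comp (by fun_prop)
  simp_rw [hAe]
  rw [lintegral_lintegral_swap (f := fun r w => A.indicator 1 (w - r • e) * F w)
    (hmeas.aemeasurable.mul hF.comp_snd), ← lintegral_indicator hU, ← lintegral_const_mul'']
  swap
  · exact hF.indicator hU
  refine lintegral_mono fun w => ?_
  have hs : MeasurableSet {r : ℝ | w - r • e ∈ A} := by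
    have : Measurable (fun r : ℝ => w - r • e) := by fun_prop
    exact this hA
  rw [lintegral_mul_const _ (f := fun r : ℝ => A.indicator 1 (w - r • e))
    (hmeas.comp (by fun_prop : Measurable fun r : ℝ => (r, w)))]
  have hI : ∫⁻ r in Ioc 0 τ, A.indicator (1 : ℝ × ℝ → ENNReal) (w - r • e)
      = volume {r ∈ Ioc 0 τ | w - r • e ∈ A} := by
    have : (fun r : ℝ => A.indicator (1 : ℝ × ℝ → ENNReal) (w - r • e))
        = {r : ℝ | w - r • e ∈ A}.indicator 1 := by
      funext r; by_cases hr : w - r • e ∈ A <;> simp [hr]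
    rw [this, lintegral_indicator_one hs, Measure.restrict_apply hs]
    congr 1; ext r; simp [and_comm]
  rw [hI]
  by_cases hw : w ∈ U
  · simpa [hw] using mul_le_mul_left (hd w) (F w)
  · have : {r ∈ Ioc 0 τ | w - r • e ∈ A} = ∅ := by
      ext r
      refine iff_of_false ?_ (notMem_empty r)
      rintro ⟨hr, hrA⟩
      exact hw (by simpa using hseg _ hrA r (Ioc_subset_Icc_self hr))
    rw [this]; simp

theorem enorm_integral_sq_le {α : Type*} [MeasurableSpace α] (μ : Measure α) (w : α → ℝ)
    (hw : AEMeasurable w μ) : ‖∫ r, w r ∂μ‖ₑ ^ 2 ≤ μ univ * ∫⁻ r, ‖w r‖ₑ ^ 2 ∂μ := by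
  have h1 := ENNReal.lintegral_mul_le_Lp_mul_Lq μ (p := 2) (q := 2) Real.HolderConjugate.two_two
    (f := fun _ => (1 : ENNReal)) (g := fun r => ‖w r‖ₑ) aemeasurable_const hw.enorm
  have h2 : ‖∫ r, w r ∂μ‖ₑ ≤ (μ univ) ^ (1 / 2 : ℝ) * (∫⁻ r, ‖w r‖ₑ ^ 2 ∂μ) ^ (1 / 2 : ℝ) := by
    refine (enorm_integral_le_lintegral_enorm _).trans ?_
    simpa using h1
  have hsq : ∀ x : ENNReal, (x ^ (1 / 2 : ℝ)) ^ 2 = x := fun x => by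
    rw [← ENNReal.rpow_natCast, ← ENNReal.rpow_mul]; norm_num
  calc _ ≤ _ := pow_le_pow_left' h2 2
    _ = _ := by rw [mul_pow, hsq, hsq]

theorem enorm_sub_sq_le (a b : ℝ) : ‖a - b‖ₑ ^ 2 ≤ 2 * ‖a‖ₑ ^ 2 + 2 * ‖b‖ₑ ^ 2 := by
  simp only [Real.enorm_eq_ofReal_abs, ← ENNReal.ofReal_pow (abs_nonneg _), sq_abs]
  rw [show (2 : ENNReal) = ENNReal.ofReal 2 by simp, ← ENNReal.ofReal_mul (by norm_num),
    ← ENNReal.ofReal_mul (by norm_num), ← ENNReal.ofReal_add (by positivity) (by positivity)]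
  exact ENNReal.ofReal_le_ofReal (by nlinarith [sq_nonneg (a + b)])

/-- Cauchy–Schwarz on the segment of length `τ` costs one factor `τ`; integrating over `A` then
counts each point of `U` with weight at most `d`. -/
theorem IsWeakDirDeriv.energy_le_translate {U A : Set (ℝ × ℝ)} (hU : IsOpen U) (hA : IsOpen A)
    {e : ℝ × ℝ} {τ : ℝ} (hτ : 0 ≤ τ) {d : ENNReal} {f v : ℝ × ℝ → ℝ} (hf : Integrable f)
    (hv : Integrable v) (h : IsWeakDirDeriv U e f v)
    (hseg : ∀ z ∈ A, ∀ r ∈ Icc 0 τ, z + r • e ∈ U)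
    (hd : ∀ w : ℝ × ℝ, volume {r ∈ Ioc 0 τ | w - r • e ∈ A} ≤ d) :
    energy A f ≤ 2 * (∫⁻ z in A, ‖f (z + τ • e)‖ₑ ^ 2)
      + 2 * (ENNReal.ofReal τ * (d * energy U v)) := by
  have hpt := ae_translate_sub_eq_integral hA hτ hf hv h hseg
  have hqm := quasiMeasurePreserving_add_smul e (volume.restrict (Ioc 0 τ))
  have hvm : AEMeasurable (fun p : ℝ × (ℝ × ℝ) => v (p.2 + p.1 • e))
      ((volume.restrict (Ioc 0 τ)).prod volume) :=
    hv.aemeasurable.comp_quasiMeasurePreserving hqm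
  have hft : AEMeasurable (fun z => f (z + τ • e)) := (hf.comp_add_right _).aemeasurable
  have hvz : ∀ᵐ z, AEMeasurable (fun r => v (z + r • e)) (volume.restrict (Ioc 0 τ)) := by
    filter_upwards [hvm.prod_swap.aestronglyMeasurable.prodMk_left] with z hz
    exact hz.aemeasurable
  calc energy A f ≤ ∫⁻ z in A, (2 * ‖f (z + τ • e)‖ₑ ^ 2
        + 2 * (ENNReal.ofReal τ * ∫⁻ r in Ioc 0 τ, ‖v (z + r • e)‖ₑ ^ 2)) := by
        refine lintegral_mono_ae ?_
        rw [ae_restrict_iff' hA.measurableSet]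
        filter_upwards [hpt, hvz] with z hz hm hzA
        have h1 : f z = f (z + τ • e) - ∫ r in Ioc 0 τ, v (z + r • e) := by
          rw [← hz hzA]; ring
        have h2 := enorm_integral_sq_le _ _ hm
        simp only [Measure.restrict_apply_univ, Real.volume_Ioc, sub_zero] at h2
        rw [h1]
        exact (enorm_sub_sq_le _ _).trans (by gcongr)
    _ = 2 * (∫⁻ z in A, ‖f (z + τ • e)‖ₑ ^ 2)
        + 2 * (ENNReal.ofReal τ * ∫⁻ z in A, ∫⁻ r in Ioc 0 τ, ‖v (z + r • e)‖ₑ ^ 2) := by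
        rw [lintegral_add_left' ((hft.enorm.pow_const 2).const_mul 2).restrict,
          lintegral_const_mul' _ _ (by simp), lintegral_const_mul' _ _ (by simp),
          lintegral_const_mul' _ _ (by simp)]
    _ ≤ _ := by
        gcongr
        rw [lintegral_lintegral_swap]
        · exact lintegral_lintegral_translate_le hU.measurableSet hA.measurableSet
            (F := fun z => ‖v z‖ₑ ^ 2) (hv.aemeasurable.enorm.pow_const 2) hseg hd
        · exact (hvm.prod_swap.mono_ac
            (Measure.restrict_le_self.absolutelyContinuous.prod
              Measure.AbsolutelyContinuous.rfl)).enorm.pow_const 2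

/-- Averaging `IsWeakDirDeriv.energy_le_translate` over `τ ∈ (0, h]` turns the translated term into
an overlap integral as well, so that both terms on the right gain the small factor `d`. -/
theorem IsWeakDirDeriv.mul_energy_le {U A : Set (ℝ × ℝ)} (hU : IsOpen U) (hA : IsOpen A)
    {e : ℝ × ℝ} {h : ℝ} {d : ENNReal} {f v : ℝ × ℝ → ℝ} (hf : Integrable f)
    (hv : Integrable v) (hfv : IsWeakDirDeriv U e f v)
    (hseg : ∀ z ∈ A, ∀ r ∈ Icc 0 h, z + r • e ∈ U)
    (hd : ∀ w : ℝ × ℝ, volume {r ∈ Ioc 0 h | w - r • e ∈ A} ≤ d) :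
    ENNReal.ofReal h * energy A f ≤ 2 * (d * energy U f)
      + 2 * (ENNReal.ofReal h ^ 2 * (d * energy U v)) := by
  have h1 : ∀ τ ∈ Ioc 0 h, energy A f ≤ 2 * (∫⁻ z in A, ‖f (z + τ • e)‖ₑ ^ 2)
      + 2 * (ENNReal.ofReal h * (d * energy U v)) := by
    intro τ hτ
    refine (hfv.energy_le_translate hU hA hτ.1.le hf hv (d := d) ?_ ?_).trans ?_
    · exact fun z hz r hr => hseg z hz r ⟨hr.1, hr.2.trans hτ.2⟩
    · exact fun w => (measure_mono fun r (hr : r ∈ Ioc 0 τ ∧ w - r • e ∈ A) =>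
        show r ∈ Ioc 0 h ∧ w - r • e ∈ A from ⟨⟨hr.1.1, hr.1.2.trans hτ.2⟩, hr.2⟩).trans (hd w)
    · gcongr; exact hτ.2
  calc ENNReal.ofReal h * energy A f = ∫⁻ _ in Ioc 0 h, energy A f := by
        simp [mul_comm]
    _ ≤ ∫⁻ τ in Ioc 0 h, (2 * (∫⁻ z in A, ‖f (z + τ • e)‖ₑ ^ 2)
      + 2 * (ENNReal.ofReal h * (d * energy U v))) := setLIntegral_mono' measurableSet_Ioc h1
    _ = 2 * (∫⁻ τ in Ioc 0 h, ∫⁻ z in A, ‖f (z + τ • e)‖ₑ ^ 2)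
      + 2 * (ENNReal.ofReal h ^ 2 * (d * energy U v)) := by
        rw [lintegral_add_right _ measurable_const, lintegral_const_mul' _ _ (by simp)]
        simp; ring
    _ ≤ _ := by
        gcongr
        exact lintegral_lintegral_translate_le hU.measurableSet hA.measurableSet
          (F := fun z => ‖f z‖ₑ ^ 2) (hf.aemeasurable.enorm.pow_const 2) hseg hd

/-! ### Transfer to `L²` norms of weak partial derivatives -/

theorem eLpNorm_sq_eq_energy (S : Set (ℝ × ℝ)) (f : ℝ × ℝ → ℝ) :
    eLpNorm f 2 (volume.restrict S) ^ 2 = energy S f := by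
  have h := eLpNorm_nnreal_pow_eq_lintegral (f := f) (p := 2) (μ := volume.restrict S) (by simp)
  simp only [NNReal.coe_ofNat, ENNReal.coe_ofNat, ENNReal.rpow_ofNat] at h
  exact h

theorem l2Norm_sq (S : Set (ℝ × ℝ)) (f : ℝ × ℝ → ℝ) : l2Norm S f ^ 2 = (energy S f).toReal := by
  rw [l2Norm, ← ENNReal.toReal_pow, eLpNorm_sq_eq_energy]

theorem energy_mono {S T : Set (ℝ × ℝ)} (h : S ⊆ T) (f : ℝ × ℝ → ℝ) : energy S f ≤ energy T f :=
  lintegral_mono_set h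

theorem energy_ne_top {S T : Set (ℝ × ℝ)} {f : ℝ × ℝ → ℝ} (h : S ⊆ T)
    (hf : MemLp f 2 (volume.restrict T)) : energy S f ≠ ⊤ := by
  refine ne_top_of_le_ne_top ?_ (energy_mono h f)
  rw [← eLpNorm_sq_eq_energy]
  exact ENNReal.pow_ne_top hf.2.ne

theorem l2Norm_sq_mono {S T : Set (ℝ × ℝ)} (h : S ⊆ T) {f : ℝ × ℝ → ℝ}
    (hf : MemLp f 2 (volume.restrict T)) : l2Norm S f ^ 2 ≤ l2Norm T f ^ 2 := by
  rw [l2Norm_sq, l2Norm_sq]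
  exact ENNReal.toReal_mono (energy_ne_top subset_rfl hf) (energy_mono h f)

theorem energy_indicator {S T : Set (ℝ × ℝ)} (hS : MeasurableSet S) (h : S ⊆ T) (f : ℝ × ℝ → ℝ) :
    energy S (T.indicator f) = energy S f :=
  setLIntegral_congr_fun hS fun z hz => by simp only [indicator_of_mem (h hz)]

/-- Test functions supported in `U` do not see the truncation to `U`, so the translation lemmas may
work with globally integrable functions. The sign `σ` allows translation against a coordinate axis.
-/
theorem HasWeakPartial.isWeakDirDeriv {U W : Set (ℝ × ℝ)} {i : Fin 2} {u v : ℝ × ℝ → ℝ}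
    (h : HasWeakPartial W i u v) (hUW : U ⊆ W) (σ : ℝ) :
    IsWeakDirDeriv U (σ • dir i) (U.indicator u) (U.indicator (fun z => σ * v z)) := by
  intro φ hφ hc hs
  have h0 : ∀ z, z ∉ U → φ z = 0 := fun z hz => by
    by_contra hne
    exact hz (hs (subset_tsupport φ hne))
  have h0' : ∀ z, z ∉ U → fderiv ℝ φ z (dir i) = 0 := fun z hz => by
    rw [fderiv_of_notMem_tsupport ℝ (fun hz' => hz (hs hz'))]; simp
  have h1 := h.2.2 φ hφ hc (hs.trans hUW)
  rw [setIntegral_eq_integral_of_forall_compl_eq_zero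
      (fun z hz => by rw [h0' z (fun hz' => hz (hUW hz')), mul_zero]),
    setIntegral_eq_integral_of_forall_compl_eq_zero
      (fun z hz => by rw [h0 z (fun hz' => hz (hUW hz')), mul_zero])] at h1
  have e1 : ∀ z, U.indicator u z * fderiv ℝ φ z (σ • dir i)
      = σ * (u z * fderiv ℝ φ z (dir i)) := fun z => by
    by_cases hz : z ∈ U
    · simp [hz]; ring
    · simp [hz, h0' z hz]
  have e2 : ∀ z, U.indicator (fun z => σ * v z) z * φ z = σ * (v z * φ z) := fun z => by
    by_cases hz : z ∈ U
    · simp [hz]; ring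
    · simp [hz, h0 z hz]
  simp_rw [e1, e2]
  rw [integral_const_mul, integral_const_mul, h1]; ring

theorem integrable_indicator_of_memLp {U W : Set (ℝ × ℝ)} (hU : MeasurableSet U)
    (hfin : volume U ≠ ⊤) (hUW : U ⊆ W) {f : ℝ × ℝ → ℝ} (hf : MemLp f 2 (volume.restrict W)) :
    Integrable (U.indicator f) := by
  rw [integrable_indicator_iff hU]
  have : IsFiniteMeasure (volume.restrict U) := ⟨by simpa using hfin.lt_top⟩
  exact (hf.mono_measure (Measure.restrict_mono hUW le_rfl)).integrable (by norm_num)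

theorem energy_indicator_smul {U : Set (ℝ × ℝ)} (hU : MeasurableSet U) {σ : ℝ} (hσ : |σ| = 1)
    (v : ℝ × ℝ → ℝ) : energy U (U.indicator (fun z => σ * v z)) = energy U v := by
  rw [energy_indicator hU subset_rfl]
  have : ‖σ‖ₑ = 1 := by rw [Real.enorm_eq_ofReal_abs, hσ]; simp
  simp [energy, enorm_mul, this]

/-- The `L²` norm over a set `A` of small extent `d` in a coordinate direction is controlled by the
norms of the function and its derivative over a set containing all translates of `A` up to length
`h`. -/
theorem HasWeakPartial.mul_l2Norm_sq_le {W U A : Set (ℝ × ℝ)} (hU : IsOpen U) (hA : IsOpen A)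
    (hfin : volume U ≠ ⊤) (hUW : U ⊆ W) {i : Fin 2} {σ : ℝ} (hσ : |σ| = 1) {h d : ℝ} (hh : 0 ≤ h)
    (hd0 : 0 ≤ d) {u v : ℝ × ℝ → ℝ} (huv : HasWeakPartial W i u v)
    (hu : MemLp u 2 (volume.restrict W)) (hv : MemLp v 2 (volume.restrict W))
    (hseg : ∀ z ∈ A, ∀ r ∈ Icc 0 h, z + r • σ • dir i ∈ U)
    (hd : ∀ w : ℝ × ℝ, volume {r ∈ Ioc 0 h | w - r • σ • dir i ∈ A} ≤ ENNReal.ofReal d) :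
    h * l2Norm A u ^ 2 ≤ 2 * d * l2Norm U u ^ 2 + 2 * h ^ 2 * d * l2Norm U v ^ 2 := by
  have hAU : A ⊆ U := fun z hz => by simpa using hseg z hz 0 ⟨le_rfl, hh⟩
  have key := (huv.isWeakDirDeriv hUW σ).mul_energy_le hU hA
    (integrable_indicator_of_memLp hU.measurableSet hfin hUW hu)
    (integrable_indicator_of_memLp hU.measurableSet hfin hUW (hv.const_mul σ)) hseg hd
  rw [energy_indicator hA.measurableSet hAU, energy_indicator hU.measurableSet subset_rfl,
    energy_indicator_smul hU.measurableSet hσ] at key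
  have hu' := energy_ne_top hUW hu
  have hv' := energy_ne_top hUW hv
  have := ENNReal.toReal_mono (by finiteness) key
  rw [ENNReal.toReal_add (by finiteness) (by finiteness)] at this
  simp only [ENNReal.toReal_mul, ENNReal.toReal_pow, ENNReal.toReal_ofReal hh,
    ENNReal.toReal_ofReal hd0, ENNReal.toReal_ofNat, ← l2Norm_sq] at this
  linarith

/-- The `L²` norm over `A` is controlled by the norm over a translate of `A` by a vector of length
`τ` in a coordinate direction and by `τ` times the norm of the derivative in between. -/
theorem HasWeakPartial.l2Norm_sq_le_translate {W U A B : Set (ℝ × ℝ)} (hU : IsOpen U)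
    (hA : IsOpen A) (hB : MeasurableSet B) (hBU : B ⊆ U) (hfin : volume U ≠ ⊤) (hUW : U ⊆ W)
    {i : Fin 2} {σ : ℝ} (hσ : |σ| = 1) {τ : ℝ} (hτ : 0 ≤ τ)
    {u v : ℝ × ℝ → ℝ} (huv : HasWeakPartial W i u v)
    (hu : MemLp u 2 (volume.restrict W)) (hv : MemLp v 2 (volume.restrict W))
    (hseg : ∀ z ∈ A, ∀ r ∈ Icc 0 τ, z + r • σ • dir i ∈ U)
    (hAB : ∀ z ∈ A, z + τ • σ • dir i ∈ B) :
    l2Norm A u ^ 2 ≤ 2 * l2Norm B u ^ 2 + 2 * τ ^ 2 * l2Norm U v ^ 2 := by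
  have hAU : A ⊆ U := fun z hz => by simpa using hseg z hz 0 ⟨le_rfl, hτ⟩
  -- The choice `d = τ` is the trivial overlap bound, the whole length of the parameter interval.
  have key := (huv.isWeakDirDeriv hUW σ).energy_le_translate hU hA hτ (d := ENNReal.ofReal τ)
    (integrable_indicator_of_memLp hU.measurableSet hfin hUW hu)
    (integrable_indicator_of_memLp hU.measurableSet hfin hUW (hv.const_mul σ)) hseg
    (fun w => (measure_mono (sep_subset _ _)).trans (by simp))
  rw [energy_indicator hA.measurableSet hAU, energy_indicator_smul hU.measurableSet hσ] at key
  have htr : ∫⁻ z in A, ‖U.indicator u (z + τ • σ • dir i)‖ₑ ^ 2 ≤ energy B u := by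
    rw [energy, ← lintegral_indicator hB, ← lintegral_indicator hA.measurableSet,
      ← lintegral_add_right_eq_self (B.indicator fun z => ‖u z‖ₑ ^ 2) (τ • σ • dir i)]
    refine lintegral_mono fun z => ?_
    by_cases hz : z ∈ A
    · simp [hz, hAB z hz, hBU (hAB z hz)]
    · simp [hz]
  have hu' := energy_ne_top (hBU.trans hUW) hu
  have hv' := energy_ne_top hUW hv
  have := ENNReal.toReal_mono (by finiteness)
    (key.trans (add_le_add_left (mul_le_mul_right htr 2) _))
  rw [ENNReal.toReal_add (by finiteness) (by finiteness)] at this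
  simp only [ENNReal.toReal_mul, ENNReal.toReal_ofReal hτ,
    ENNReal.toReal_ofNat, ← l2Norm_sq] at this
  linarith

/-! ### The domain near the origin -/

/-- The defining function `ρ` vanishes on the vertical segment, so its nonzero gradient at the
origin is horizontal. It must point right, since otherwise `Ω` would contain points with `x > 0`.
Then `ρ` increases along horizontals up to its value `0` at `x = 0`, hence is negative just to the
left. -/
theorem exists_rectangle_subset {Ω : Set (ℝ × ℝ)} (hΩ : IsSmoothBoundedDomain Ω)
    (hseg : ∀ y ∈ Icc (-1 : ℝ) 1, ((0 : ℝ), y) ∈ frontier Ω) (hleft : ∀ z ∈ Ω, z.1 < 0) :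
    ∃ η : ℝ, 0 < η ∧ Ioo (-η) 0 ×ˢ Ioo (-η) η ⊆ Ω := by
  obtain ⟨V, hV, h0V, ρ, hρ, hne, hΩV⟩ := hΩ.smooth (0, 0) (hseg 0 (by simp))
  have hmem : ∀ z ∈ V, (z ∈ Ω ↔ ρ z < 0) := fun z hz => by
    have := Set.ext_iff.1 hΩV z
    exact ⟨fun h => (this.1 ⟨h, hz⟩).2, fun h => (this.2 ⟨hz, h⟩).1⟩
  have hzero : ∀ y ∈ Icc (-1 : ℝ) 1, ((0 : ℝ), y) ∈ V → ρ (0, y) = 0 := by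
    intro y hy hyV
    apply le_antisymm
    -- A frontier point is a limit of points of `Ω`, where `ρ < 0`.
    · by_contra! hpos
      have hn : ∀ᶠ z in 𝓝 ((0 : ℝ), y), 0 < ρ z :=
        (hρ.continuousOn.continuousAt (hV.mem_nhds hyV)).eventually_const_lt hpos
      have hcl := mem_closure_iff_frequently.1 (frontier_subset_closure (hseg y hy))
      obtain ⟨z, hzΩ, hz, hzV⟩ := (hcl.and_eventually (hn.and (hV.mem_nhds hyV))).exists
      exact lt_asymm hz ((hmem z hzV).1 hzΩ)
    · by_contra! hneg
      exact lt_irrefl _ (hleft _ ((hmem _ hyV).2 hneg))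
  have hdiff : ∀ z ∈ V, HasFDerivAt ρ (fderiv ℝ ρ z) z := fun z hz =>
    ((hρ.differentiableOn (by simp)).differentiableAt (hV.mem_nhds hz)).hasFDerivAt
  have hcont : ContinuousAt (fun z => fderiv ℝ ρ z (1, 0)) (0, 0) :=
    ((hρ.continuousOn_fderiv_of_isOpen hV (by simp)).continuousAt
      (hV.mem_nhds h0V)).clm_apply continuousAt_const
  have hy0 : fderiv ℝ ρ (0, 0) (0, 1) = 0 := by
    have h1 : HasDerivAt (fun y : ℝ => ((0 : ℝ), y)) (0, 1) 0 :=
      (hasDerivAt_const _ _).prodMk (hasDerivAt_id _)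
    have h2 : HasDerivAt (fun y : ℝ => ρ (0, y)) (fderiv ℝ ρ (0, 0) (0, 1)) 0 :=
      (hdiff _ h0V).comp_hasDerivAt (0 : ℝ) h1
    have h3 : (fun y : ℝ => ρ (0, y)) =ᶠ[𝓝 0] fun _ => (0 : ℝ) := by
      have hc : ContinuousAt (fun y : ℝ => ((0 : ℝ), y)) 0 := by fun_prop
      filter_upwards [hc (hV.mem_nhds h0V), Icc_mem_nhds (by norm_num : (-1 : ℝ) < 0) one_pos]
        with y hyV hy using hzero y hy hyV
    exact h2.unique ((hasDerivAt_const (0 : ℝ) (0 : ℝ)).congr_of_eventuallyEq h3)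
  have hx0 : fderiv ℝ ρ (0, 0) (1, 0) ≠ 0 := by
    intro hx
    refine hne _ h0V (ContinuousLinearMap.ext fun z => ?_)
    have : z = z.1 • ((1 : ℝ), (0 : ℝ)) + z.2 • ((0 : ℝ), (1 : ℝ)) := by ext <;> simp
    rw [this, map_add, map_smul, map_smul, hx, hy0]; simp
  have hline : ∀ x y : ℝ, (x, y) ∈ V →
      HasDerivAt (fun x : ℝ => ρ (x, y)) (fderiv ℝ ρ (x, y) (1, 0)) x := fun x y h =>
    (hdiff _ h).comp_hasDerivAt x ((hasDerivAt_id x).prodMk (hasDerivAt_const x y))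
  have hsquare : ∀ P : ℝ × ℝ → Prop, (∀ᶠ z in 𝓝 (0, 0), P z) →
      ∃ η : ℝ, 0 < η ∧ η ≤ 1 ∧ ∀ x ∈ Ioo (-η) η, ∀ y ∈ Ioo (-η) η, P (x, y) := by
    intro P hP
    obtain ⟨η, hη, hb⟩ := Metric.eventually_nhds_iff_ball.1 hP
    refine ⟨min η 1, lt_min hη one_pos, min_le_right _ _, fun x hx y hy => hb _ ?_⟩
    rw [Metric.mem_ball, Prod.dist_eq, max_lt_iff, Real.dist_eq, Real.dist_eq, sub_zero, sub_zero,
      abs_lt, abs_lt]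
    have := min_le_left η 1
    exact ⟨⟨by linarith [hx.1], by linarith [hx.2]⟩, ⟨by linarith [hy.1], by linarith [hy.2]⟩⟩
  rcases hx0.lt_or_gt with hlt | hgt
  · exfalso
    obtain ⟨η, hη, -, hP⟩ := hsquare _ ((hcont.eventually_lt_const hlt).and (hV.mem_nhds h0V))
    have hin : ∀ x ∈ Icc 0 (η / 2), x ∈ Ioo (-η) η := fun x hx =>
      ⟨by linarith [hx.1], by linarith [hx.2]⟩
    have h0 : (0 : ℝ) ∈ Ioo (-η) η := ⟨by linarith, hη⟩
    have hanti : StrictAntiOn (fun x : ℝ => ρ (x, 0)) (Icc 0 (η / 2)) := by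
      refine strictAntiOn_of_deriv_neg (convex_Icc _ _) (fun x hx =>
        (hline x 0 (hP x (hin x hx) 0 h0).2).continuousAt.continuousWithinAt) fun x hx => ?_
      have hx' := hP x (hin x (interior_subset hx)) 0 h0
      rw [(hline x 0 hx'.2).deriv]
      exact hx'.1
    have h1 := hanti ⟨le_rfl, by linarith⟩ ⟨by linarith, le_rfl⟩ (by linarith : (0 : ℝ) < η / 2)
    simp only [hzero 0 (by simp) h0V] at h1
    have h2 := hleft _ ((hmem _ (hP _ (hin _ ⟨by linarith, le_rfl⟩) 0 h0).2).2 h1)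
    simp only at h2
    linarith
  · obtain ⟨η, hη, hη1, hP⟩ := hsquare _ ((hcont.eventually_const_lt hgt).and (hV.mem_nhds h0V))
    refine ⟨η, hη, ?_⟩
    rintro ⟨x, y⟩ ⟨hx, hy⟩
    simp only at hx hy
    have hin : ∀ t ∈ Icc x 0, t ∈ Ioo (-η) η := fun t ht =>
      ⟨by linarith [ht.1, hx.1], by linarith [ht.2]⟩
    have hmono : StrictMonoOn (fun x : ℝ => ρ (x, y)) (Icc x 0) := by
      refine strictMonoOn_of_deriv_pos (convex_Icc _ _) (fun t ht =>
        (hline t y (hP t (hin t ht) y hy).2).continuousAt.continuousWithinAt) fun t ht => ?_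
      have ht' := hP t (hin t (interior_subset ht)) y hy
      rw [(hline t y ht'.2).deriv]
      exact ht'.1
    have h1 := hmono ⟨le_rfl, hx.2.le⟩ ⟨hx.2.le, le_rfl⟩ hx.2
    simp only at h1
    rw [hzero y ⟨by linarith [hy.1], by linarith [hy.2]⟩
      (hP 0 ⟨by linarith, hη⟩ y hy).2] at h1
    exact (hmem _ (hP x (hin x ⟨le_rfl, hx.2.le⟩) y hy).2).2 h1

/-! ### Chosen representatives of the derivatives of an `H²` function -/

/-- Needed because `MemH2` gives second derivatives of some representative of `∂ᵢu`, whereas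
`h2Norm` differentiates the one chosen by `weakPartial`. -/
theorem HasWeakPartial.congr {U : Set (ℝ × ℝ)} {i : Fin 2} {u u' v : ℝ × ℝ → ℝ}
    (h : HasWeakPartial U i u v) (hu' : LocallyIntegrableOn u' U)
    (huu' : u =ᵐ[volume.restrict U] u') : HasWeakPartial U i u' v := by
  refine ⟨hu', h.2.1, fun φ hφ hc hs => ?_⟩
  rw [← h.2.2 φ hφ hc hs]
  refine integral_congr_ae ?_
  filter_upwards [huu'] with z hz
  rw [hz]

theorem MemH2.weakPartial {U : Set (ℝ × ℝ)} (hU : IsOpen U) {u : ℝ × ℝ → ℝ} (h : MemH2 U u)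
    (i : Fin 2) : HasWeakPartial U i u (weakPartial U i u) ∧
      MemLp (weakPartial U i u) 2 (volume.restrict U) := by
  obtain ⟨v, hv, hvm, -⟩ := h.2 i
  have hw := hasWeakPartial_weakPartial hv
  exact ⟨hw, hvm.ae_eq (hv.ae_unique hU hw)⟩

theorem MemH2.weakPartial_weakPartial {U : Set (ℝ × ℝ)} (hU : IsOpen U) {u : ℝ × ℝ → ℝ}
    (h : MemH2 U u) (i j : Fin 2) :
    HasWeakPartial U j (ThinChannel.weakPartial U i u)
        (ThinChannel.weakPartial U j (ThinChannel.weakPartial U i u)) ∧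
      MemLp (ThinChannel.weakPartial U j (ThinChannel.weakPartial U i u)) 2
        (volume.restrict U) := by
  obtain ⟨v, hv, hvm, hv2⟩ := h.2 i
  obtain ⟨w, hw, hwm⟩ := hv2 j
  have h1 := hasWeakPartial_weakPartial hv
  have h2 := hw.congr h1.2.1 (hv.ae_unique hU h1)
  have h3 := hasWeakPartial_weakPartial h2
  exact ⟨h3, hwm.ae_eq (h2.ae_unique hU h3)⟩

theorem l2Norm_sq_le_of_h2Norm_le {U : Set (ℝ × ℝ)} {u : ℝ × ℝ → ℝ} {R : ℝ}
    (h : h2Norm U u ≤ R) :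
    l2Norm U u ^ 2 ≤ R ^ 2 ∧ (∀ i, l2Norm U (weakPartial U i u) ^ 2 ≤ R ^ 2) ∧
      ∀ i j, l2Norm U (weakPartial U j (weakPartial U i u)) ^ 2 ≤ R ^ 2 := by
  have h1 := (Real.sqrt_le_iff.1 h).2
  have hi : ∀ i, l2Norm U (weakPartial U i u) ^ 2 ≤ ∑ i, l2Norm U (weakPartial U i u) ^ 2 :=
    fun i => Finset.single_le_sum (f := fun i => l2Norm U (weakPartial U i u) ^ 2)
      (fun _ _ => sq_nonneg _) (Finset.mem_univ i)
  have hij : ∀ i j, l2Norm U (weakPartial U j (weakPartial U i u)) ^ 2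
      ≤ ∑ i, ∑ j, l2Norm U (weakPartial U j (weakPartial U i u)) ^ 2 := fun i j =>
    (Finset.single_le_sum (f := fun j => l2Norm U (weakPartial U j (weakPartial U i u)) ^ 2)
      (fun _ _ => sq_nonneg _) (Finset.mem_univ j)).trans
    (Finset.single_le_sum
      (f := fun i => ∑ j, l2Norm U (weakPartial U j (weakPartial U i u)) ^ 2)
      (fun _ _ => Finset.sum_nonneg fun _ _ => sq_nonneg _) (Finset.mem_univ i))
  have h0 := sq_nonneg (l2Norm U u)
  have h2 : 0 ≤ ∑ i, l2Norm U (weakPartial U i u) ^ 2 :=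
    Finset.sum_nonneg fun _ _ => sq_nonneg _
  have h3 : 0 ≤ ∑ i, ∑ j, l2Norm U (weakPartial U j (weakPartial U i u)) ^ 2 :=
    Finset.sum_nonneg fun _ _ => Finset.sum_nonneg fun _ _ => sq_nonneg _
  exact ⟨by linarith, fun i => by linarith [hi i], fun i j => by linarith [hij i j]⟩

/-! ### The prolonged channel -/

/-- The profile `g`, extended by constants to the whole line. -/
def profileExt (g : ℝ → ℝ) (x : ℝ) : ℝ := g (max 0 (min 1 x))

theorem continuous_profileExt {g : ℝ → ℝ} (hg : ContinuousOn g (Icc 0 1)) :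
    Continuous (profileExt g) :=
  hg.comp_continuous (by fun_prop) fun x => ⟨le_max_left _ _, max_le zero_le_one (min_le_left _ _)⟩

theorem profileExt_of_mem {g : ℝ → ℝ} {x : ℝ} (h0 : 0 ≤ x) (h1 : x ≤ 1) :
    profileExt g x = g x := by
  rw [profileExt, min_eq_right h1, max_eq_right h0]

theorem profileExt_of_nonpos {g : ℝ → ℝ} {x : ℝ} (h0 : x ≤ 0) : profileExt g x = g 0 := by
  rw [profileExt, max_eq_left ((min_le_right _ _).trans h0)]

/-- Clamping to `[0, 1]` is monotone and sends `(-∞, δ)` into `[0, δ)`, so (MP) extends to the whole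
half-line left of `δ`. -/
theorem profileExt_anti {g : ℝ → ℝ} {δ : ℝ} (hδ : 0 < δ)
    (h : AntitoneOn g (Ico 0 δ)) {x y : ℝ} (hxy : x ≤ y) (hy : y < δ) :
    profileExt g y ≤ profileExt g x := by
  have hmem : ∀ t, t < δ → max 0 (min 1 t) ∈ Ico 0 δ := fun t ht =>
    ⟨le_max_left _ _, max_lt hδ (min_lt_of_right_lt ht)⟩
  exact h (hmem x (hxy.trans_lt hy)) (hmem y hy) (by gcongr)

theorem isOpen_subgraph {G : ℝ → ℝ} (hG : Continuous G) (p q ε : ℝ) :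
    IsOpen {z : ℝ × ℝ | p < z.1 ∧ z.1 < q ∧ 0 < z.2 ∧ z.2 < ε * G z.1} :=
  (isOpen_lt continuous_const continuous_fst).inter <|
    (isOpen_lt continuous_fst continuous_const).inter <|
    (isOpen_lt continuous_const continuous_snd).inter <|
    isOpen_lt continuous_snd (continuous_const.mul (hG.comp continuous_fst))

/-- The part `-a < x < a` of the dumbbell next to the junction, with the channel prolonged to the
left. -/
def neck (g : ℝ → ℝ) (a ε : ℝ) : Set (ℝ × ℝ) :=
  {z | -a < z.1 ∧ z.1 < a ∧ 0 < z.2 ∧ z.2 < ε * profileExt g z.1}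

theorem isOpen_neck {g : ℝ → ℝ} (hg : ContinuousOn g (Icc 0 1)) (a ε : ℝ) :
    IsOpen (neck g a ε) := isOpen_subgraph (continuous_profileExt hg) _ _ _

theorem channelEnd_eq {g : ℝ → ℝ} {θ ε : ℝ} (ha : ε ^ θ ≤ 1) :
    channelEnd g θ ε = neck g (ε ^ θ) ε ∩ {z | 0 < z.1} := by
  ext z
  constructor
  · rintro ⟨⟨h1, h2, h3, h4⟩, -, h5⟩
    rw [← profileExt_of_mem (g := g) h1.le h2.le] at h4
    exact ⟨⟨by linarith, h5, h3, h4⟩, h1⟩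
  · rintro ⟨⟨h1, h2, h3, h4⟩, h5 : 0 < z.1⟩
    rw [profileExt_of_mem h5.le (h2.le.trans ha)] at h4
    exact ⟨⟨h5, h2.trans_le ha, h3, h4⟩, h5, h2⟩

theorem neck_subset_dumbbell {Ω : Set (ℝ × ℝ)} {g : ℝ → ℝ} {a ε η : ℝ}
    (hΩ : Ioo (-η) 0 ×ˢ Ioo (-η) η ⊆ Ω) (ha : a ≤ 1) (haη : a ≤ η)
    (hb : ε * g 0 ≤ η) : neck g a ε ⊆ dumbbell Ω g ε := by
  rintro z ⟨h1, h2, h3, h4⟩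
  rcases lt_trichotomy z.1 0 with h | h | h
  · rw [profileExt_of_nonpos h.le] at h4
    exact Or.inl (Or.inl (hΩ ⟨⟨by linarith, h⟩, ⟨by linarith, by linarith⟩⟩))
  · rw [profileExt_of_nonpos h.le] at h4
    exact Or.inr ⟨h, h3, h4⟩
  · rw [profileExt_of_mem h.le (by linarith)] at h4
    exact Or.inl (Or.inr ⟨h, by linarith, h3, h4⟩)

theorem isOpen_channel {g : ℝ → ℝ} (hg : ContinuousOn g (Icc 0 1)) (ε : ℝ) :
    IsOpen (channel g ε) := by
  have hc := continuous_profileExt hg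
  have : channel g ε = {z | 0 < z.1 ∧ z.1 < 1 ∧ 0 < z.2 ∧ z.2 < ε * profileExt g z.1} := by
    ext z
    constructor
    · rintro ⟨h1, h2, h3, h4⟩
      rw [← profileExt_of_mem (g := g) h1.le h2.le] at h4
      exact ⟨h1, h2, h3, h4⟩
    · rintro ⟨h1, h2, h3, h4⟩
      rw [profileExt_of_mem (g := g) h1.le h2.le] at h4
      exact ⟨h1, h2, h3, h4⟩
  rw [this]
  exact isOpen_subgraph hc _ _ _

/-- The junction is not open by itself, but it may be replaced in the union by the open neck that
contains it. -/
theorem isOpen_dumbbell {Ω : Set (ℝ × ℝ)} (hΩo : IsOpen Ω) {g : ℝ → ℝ}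
    (hg : ContinuousOn g (Icc 0 1)) {a ε η : ℝ}
    (hΩ : Ioo (-η) 0 ×ˢ Ioo (-η) η ⊆ Ω) (ha0 : 0 < a) (ha : a ≤ 1) (haη : a ≤ η)
    (hb : ε * g 0 ≤ η) : IsOpen (dumbbell Ω g ε) := by
  have h1 := neck_subset_dumbbell hΩ ha haη hb
  have h2 : junction g ε ⊆ neck g a ε := by
    rintro z ⟨hz, h3, h4⟩
    rw [← profileExt_of_nonpos (g := g) hz.le] at h4
    exact ⟨by linarith, by linarith, h3, h4⟩
  have : dumbbell Ω g ε = Ω ∪ channel g ε ∪ neck g a ε := by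
    apply subset_antisymm
    · exact union_subset_union_right _ h2
    · exact union_subset subset_union_left h1
  rw [this]
  exact (hΩo.union (isOpen_channel hg ε)).union (isOpen_neck hg a ε)

/-! ### Estimates inside the domain -/

/-- Norms over the thin strip `(-η, 0) × (0, b)` are of order `b`. -/
theorem HasWeakPartial.l2Norm_strip_sq_le {D : Set (ℝ × ℝ)} {η b M : ℝ} (hη : 0 < η)
    (hb : 0 ≤ b) (hbη : b ≤ η / 2) (hD : Ioo (-η) 0 ×ˢ Ioo (-η) η ⊆ D)
    {f v : ℝ × ℝ → ℝ} (hfv : HasWeakPartial D 1 f v)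
    (hf : MemLp f 2 (volume.restrict D)) (hv : MemLp v 2 (volume.restrict D))
    (hfM : l2Norm D f ^ 2 ≤ M) (hvM : l2Norm D v ^ 2 ≤ M) :
    l2Norm (Ioo (-η) 0 ×ˢ Ioo 0 b) f ^ 2 ≤ (2 + 2 * (η / 2) ^ 2) / (η / 2) * b * M := by
  -- Upward translates by at most `η / 2` stay in the rectangle because `b ≤ η / 2`, and each
  -- vertical line meets the strip in length at most `b`.
  have key := hfv.mul_l2Norm_sq_le (σ := 1) (h := η / 2) (d := b) (A := Ioo (-η) 0 ×ˢ Ioo 0 b)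
    (isOpen_Ioo.prod isOpen_Ioo) (isOpen_Ioo.prod isOpen_Ioo)
    ((Metric.isBounded_Ioo _ _).prod (Metric.isBounded_Ioo _ _)).measure_lt_top.ne hD (by simp)
    (by positivity) hb hf hv ?_ ?_
  · have h1 := (l2Norm_sq_mono hD hf).trans hfM
    have h2 := (l2Norm_sq_mono hD hv).trans hvM
    have h3 : η / 2 * l2Norm (Ioo (-η) 0 ×ˢ Ioo 0 b) f ^ 2 ≤ (2 + 2 * (η / 2) ^ 2) * b * M := by
      refine key.trans ?_
      calc _ ≤ 2 * b * M + 2 * (η / 2) ^ 2 * b * M := by gcongr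
        _ = _ := by ring
    rw [div_mul_eq_mul_div, div_mul_eq_mul_div, le_div_iff₀ (by positivity)]
    linarith
  · rintro ⟨x, y⟩ ⟨hx, hy⟩ r ⟨hr0, hr⟩
    simp only [dir, mem_Ioo, mem_prod, Matrix.cons_val_one, Matrix.cons_val_fin_one, one_smul,
      Prod.smul_mk, smul_eq_mul, Prod.mk_add_mk, mul_zero, mul_one, add_zero] at hx hy ⊢
    exact ⟨hx, by linarith, by linarith⟩
  · intro w
    calc _ ≤ volume (Ioo (w.2 - b) w.2) := by
          refine measure_mono ?_
          rintro r ⟨hr, -, hr2⟩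
          simp only [dir, mem_Ioo, Matrix.cons_val_one, Matrix.cons_val_fin_one, one_smul,
            Prod.smul_mk, smul_eq_mul, mul_one, Prod.snd_sub] at hr2
          exact ⟨by linarith, by linarith⟩
      _ = _ := by simp

/-- Norms over a short piece `(-a, 0) × (0, b)` of the strip. -/
theorem HasWeakPartial.l2Norm_corner_sq_le {D : Set (ℝ × ℝ)} {η a b M : ℝ} (hη : 0 < η)
    (ha : 0 ≤ a) (haη : a ≤ η / 2) (hD : Ioo (-η) 0 ×ˢ Ioo 0 b ⊆ D)
    {f v : ℝ × ℝ → ℝ} (hfv : HasWeakPartial D 0 f v)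
    (hf : MemLp f 2 (volume.restrict D)) (hv : MemLp v 2 (volume.restrict D))
    (hfM : l2Norm (Ioo (-η) 0 ×ˢ Ioo 0 b) f ^ 2 ≤ M)
    (hvM : l2Norm (Ioo (-η) 0 ×ˢ Ioo 0 b) v ^ 2 ≤ M) :
    l2Norm (Ioo (-a) 0 ×ˢ Ioo 0 b) f ^ 2 ≤ (2 + 2 * (η / 2) ^ 2) / (η / 2) * a * M := by
  -- Leftward translates never leave the strip, so only norms over the strip appear on the right;
  -- this lets the gains `a` and `b` multiply.
  have key := hfv.mul_l2Norm_sq_le (σ := -1) (h := η / 2) (d := a) (A := Ioo (-a) 0 ×ˢ Ioo 0 b)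
    (isOpen_Ioo.prod isOpen_Ioo) (isOpen_Ioo.prod isOpen_Ioo)
    ((Metric.isBounded_Ioo _ _).prod (Metric.isBounded_Ioo _ _)).measure_lt_top.ne hD (by simp)
    (by positivity) ha hf hv ?_ ?_
  · have h3 : η / 2 * l2Norm (Ioo (-a) 0 ×ˢ Ioo 0 b) f ^ 2 ≤ (2 + 2 * (η / 2) ^ 2) * a * M := by
      refine key.trans ?_
      calc _ ≤ 2 * a * M + 2 * (η / 2) ^ 2 * a * M := by gcongr
        _ = _ := by ring
    rw [div_mul_eq_mul_div, div_mul_eq_mul_div, le_div_iff₀ (by positivity)]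
    linarith
  · rintro ⟨x, y⟩ ⟨hx, hy⟩ r ⟨hr0, hr⟩
    simp only [dir, mem_Ioo, mem_prod, Matrix.cons_val_zero,
      Prod.smul_mk, smul_eq_mul, Prod.mk_add_mk, mul_zero, mul_one, add_zero] at hx hy ⊢
    exact ⟨⟨by linarith, by linarith⟩, hy⟩
  · intro w
    calc _ ≤ volume (Ioo (-a - w.1) (-w.1)) := by
          refine measure_mono ?_
          rintro r ⟨hr, hr2, -⟩
          simp only [dir, mem_Ioo, Matrix.cons_val_zero,
            Prod.smul_mk, smul_eq_mul, mul_one, Prod.fst_sub] at hr2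
          exact ⟨by linarith, by linarith⟩
      _ = _ := by rw [Real.volume_Ioo]; congr 1; ring

theorem neck_inter_neg_subset (g : ℝ → ℝ) (a ε : ℝ) :
    neck g a ε ∩ {z | z.1 < 0} ⊆ Ioo (-a) 0 ×ˢ Ioo 0 (ε * g 0) := by
  rintro z ⟨⟨h1, h2, h3, h4⟩, h5 : z.1 < 0⟩
  rw [profileExt_of_nonpos h5.le] at h4
  exact ⟨⟨h1, h5⟩, h3, h4⟩

theorem corner_subset_neck {g : ℝ → ℝ} {a : ℝ} (ha : 0 ≤ a) (ε : ℝ) :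
    Ioo (-a) 0 ×ˢ Ioo 0 (ε * g 0) ⊆ neck g a ε := by
  rintro z ⟨⟨h1, h2⟩, h3, h4⟩
  rw [← profileExt_of_nonpos (g := g) h2.le] at h4
  exact ⟨h1, h2.trans_le ha, h3, h4⟩

theorem volume_neck_ne_top {g : ℝ → ℝ} {δ a ε : ℝ} (hδ : 0 < δ)
    (h : AntitoneOn g (Ico 0 δ)) (ha : a ≤ δ) (hε : 0 ≤ ε) : volume (neck g a ε) ≠ ⊤ := by
  refine (((Metric.isBounded_Ioo (-a) a).prod (Metric.isBounded_Ioo 0 (ε * profileExt g (-a)))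
    ).subset ?_).measure_lt_top.ne
  rintro z ⟨h1, h2, h3, h4⟩
  refine ⟨⟨h1, h2⟩, h3, h4.trans_le ?_⟩
  gcongr
  exact profileExt_anti hδ h h1.le (h2.trans_le ha)

/-! ### Transport from the domain into the channel -/

/-- Under the monotonicity condition, every point of the channel end is joined to its left translate
by a horizontal segment in the neck. -/
theorem HasWeakPartial.l2Norm_channelEnd_sq_le {D : Set (ℝ × ℝ)} {g : ℝ → ℝ}
    (hg : ContinuousOn g (Icc 0 1)) {δ θ ε : ℝ} (hδ : 0 < δ) (hδ1 : δ < 1)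
    (hanti : AntitoneOn g (Ico 0 δ)) (hε : 0 ≤ ε) (ha : ε ^ θ ≤ δ)
    (hD : neck g (ε ^ θ) ε ⊆ D) {f v : ℝ × ℝ → ℝ} (hfv : HasWeakPartial D 0 f v)
    (hf : MemLp f 2 (volume.restrict D)) (hv : MemLp v 2 (volume.restrict D)) :
    l2Norm (channelEnd g θ ε) f ^ 2 ≤
      2 * l2Norm (Ioo (-ε ^ θ) 0 ×ˢ Ioo 0 (ε * g 0)) f ^ 2
        + 2 * (ε ^ θ) ^ 2 * l2Norm (neck g (ε ^ θ) ε) v ^ 2 := by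
  have ha0 : 0 ≤ ε ^ θ := Real.rpow_nonneg hε θ
  rw [channelEnd_eq (ha.trans hδ1.le)]
  have hmove : ∀ z ∈ neck g (ε ^ θ) ε ∩ {z | 0 < z.1}, ∀ r ∈ Icc 0 (ε ^ θ),
      z + r • (-1 : ℝ) • dir 0 ∈ neck g (ε ^ θ) ε := by
    rintro ⟨x, y⟩ ⟨⟨h1, h2, h3, h4⟩, h5⟩ r ⟨hr0, hr⟩
    simp only [mem_ofPred_eq] at h1 h2 h3 h4 h5
    have he : ((x, y) : ℝ × ℝ) + r • (-1 : ℝ) • dir 0 = (x - r, y) := by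
      ext <;> simp [dir, sub_eq_add_neg]
    rw [he]
    refine ⟨by simp only; linarith, by simp only; linarith, h3, h4.trans_le ?_⟩
    gcongr
    exact profileExt_anti hδ hanti (by linarith) (h2.trans_le ha)
  refine hfv.l2Norm_sq_le_translate (σ := -1) (isOpen_neck hg _ _)
    ((isOpen_neck hg _ _).inter (isOpen_lt continuous_const continuous_fst))
    (measurableSet_Ioo.prod measurableSet_Ioo) (corner_subset_neck ha0 ε)
    (volume_neck_ne_top hδ hanti ha hε) hD (by simp) ha0 hf hv hmove ?_
  -- Points of the channel end have `x < ε ^ θ`, so the full translate has negative first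
  -- coordinate.
  intro z hz
  refine neck_inter_neg_subset g _ ε ⟨hmove z hz _ ⟨ha0, le_rfl⟩, ?_⟩
  have := hz.1.2.1
  simp [dir]
  linarith

/-- Up to the null line `x = 0`, the neck is the corner together with the channel end. -/
theorem l2Norm_neck_sq_le {D : Set (ℝ × ℝ)} {g : ℝ → ℝ} {θ ε : ℝ} (hε : 0 ≤ ε) (ha : ε ^ θ ≤ 1)
    (hD : neck g (ε ^ θ) ε ⊆ D) {f : ℝ × ℝ → ℝ} (hf : MemLp f 2 (volume.restrict D)) :
    l2Norm (neck g (ε ^ θ) ε) f ^ 2 ≤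
      l2Norm (Ioo (-ε ^ θ) 0 ×ˢ Ioo 0 (ε * g 0)) f ^ 2 + l2Norm (channelEnd g θ ε) f ^ 2 := by
  have ha0 : 0 ≤ ε ^ θ := Real.rpow_nonneg hε θ
  have hc : channelEnd g θ ε ⊆ neck g (ε ^ θ) ε := by
    rw [channelEnd_eq ha]; exact inter_subset_left
  have h1 := energy_ne_top ((corner_subset_neck ha0 ε).trans hD) hf
  have h2 := energy_ne_top (hc.trans hD) hf
  rw [l2Norm_sq, l2Norm_sq, l2Norm_sq, ← ENNReal.toReal_add h1 h2]
  refine ENNReal.toReal_mono (by finiteness) ?_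
  have hnull : (volume : Measure (ℝ × ℝ)) ({0} ×ˢ univ) = 0 := by
    rw [Measure.volume_eq_prod, Measure.prod_prod]; simp
  have hsub : neck g (ε ^ θ) ε ⊆
      ((Ioo (-ε ^ θ) 0 ×ˢ Ioo 0 (ε * g 0)) ∪ channelEnd g θ ε) ∪ ({0} ×ˢ univ) := by
    intro z hz
    rcases lt_trichotomy z.1 0 with h | h | h
    · exact Or.inl (Or.inl (neck_inter_neg_subset g _ ε ⟨hz, h⟩))
    · exact Or.inr ⟨h, trivial⟩
    · refine Or.inl (Or.inr ?_)
      rw [channelEnd_eq ha]; exact ⟨hz, h⟩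
  refine (energy_mono hsub f).trans ((lintegral_union_le _ _ _).trans ?_)
  rw [setLIntegral_measure_zero _ _ hnull, add_zero]
  exact lintegral_union_le _ _ _

/-! ### Assembling the bounds -/

/-- Quantitative form for a fixed `ε`, with `a = ε ^ θ`. -/
theorem MemH2.channelEnd_bounds {Ω : Set (ℝ × ℝ)} (hΩo : IsOpen Ω) {g : ℝ → ℝ}
    (hg : ContinuousOn g (Icc 0 1)) (hg0 : 0 < g 0) {δ η θ ε R : ℝ} (hδ : 0 < δ) (hδ1 : δ < 1)
    (hanti : AntitoneOn g (Ico 0 δ)) (hη : 0 < η) (hΩ : Ioo (-η) 0 ×ˢ Ioo (-η) η ⊆ Ω)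
    (hε : 0 < ε) (haδ : ε ^ θ ≤ δ) (haη : ε ^ θ ≤ η / 2) (hbη : ε * g 0 ≤ η / 2)
    (hba : ε ≤ (ε ^ θ) ^ 3) {u : ℝ × ℝ → ℝ} (hu : MemH2 (dumbbell Ω g ε) u)
    (huR : h2Norm (dumbbell Ω g ε) u ≤ R) {K : ℝ}
    (hK : K = (2 + 2 * (η / 2) ^ 2) / (η / 2)) :
    l2Norm (channelEnd g θ ε) u ^ 2
        ≤ (2 * K ^ 2 * g 0 + 6 * K * g 0 + 4) * R ^ 2 * (ε ^ θ) ^ 4 ∧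
      ∀ i, l2Norm (channelEnd g θ ε) (ThinChannel.weakPartial (dumbbell Ω g ε) i u) ^ 2
        ≤ (2 * K * g 0 + 2) * R ^ 2 * (ε ^ θ) ^ 2 := by
  set D := dumbbell Ω g ε with hDdef
  set a := ε ^ θ with ha
  have ha0 : 0 < a := Real.rpow_pos_of_pos hε θ
  have ha1 : a ≤ 1 := haδ.trans hδ1.le
  have hb0 : 0 ≤ ε * g 0 := by positivity
  have hK0 : 0 ≤ K := by rw [hK]; positivity
  have hDo : IsOpen D := isOpen_dumbbell hΩo hg hΩ ha0 ha1 (by linarith) (by linarith)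
  have hΩD : Ω ⊆ D := fun z hz => Or.inl (Or.inl hz)
  have hQD := hΩ.trans hΩD
  have hND : neck g a ε ⊆ D := neck_subset_dumbbell hΩ ha1 (by linarith) (by linarith)
  have hSQ : Ioo (-η) 0 ×ˢ Ioo 0 (ε * g 0) ⊆ Ioo (-η) 0 ×ˢ Ioo (-η) η :=
    prod_mono_right (Ioo_subset_Ioo (by linarith) (by linarith))
  have hSD := hSQ.trans hQD
  have hCS : Ioo (-a) 0 ×ˢ Ioo 0 (ε * g 0) ⊆ Ioo (-η) 0 ×ˢ Ioo 0 (ε * g 0) :=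
    prod_mono_left (Ioo_subset_Ioo_left (by linarith))
  obtain ⟨hM0, hM1, hM2⟩ := l2Norm_sq_le_of_h2Norm_le huR
  have hw := hu.weakPartial hDo
  have hww := hu.weakPartial_weakPartial hDo
  have hR : 0 ≤ R ^ 2 := sq_nonneg R
  -- The only use of `ε ≤ (ε ^ θ) ^ 3`: the strip height is of order at most `a³`.
  have hbR : ε * g 0 * R ^ 2 ≤ g 0 * R ^ 2 * a ^ 3 := by
    have : ε * (g 0 * R ^ 2) ≤ a ^ 3 * (g 0 * R ^ 2) := by gcongr
    linarith
  have hstrip0 : l2Norm (Ioo (-η) 0 ×ˢ Ioo 0 (ε * g 0)) u ^ 2 ≤ K * (ε * g 0) * R ^ 2 := by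
    rw [hK]
    exact (hw 1).1.l2Norm_strip_sq_le hη hb0 hbη hQD hu.1 (hw 1).2 hM0 (hM1 1)
  have hstrip1 : ∀ i, l2Norm (Ioo (-η) 0 ×ˢ Ioo 0 (ε * g 0)) (ThinChannel.weakPartial D i u) ^ 2
      ≤ K * (ε * g 0) * R ^ 2 := fun i => by
    rw [hK]
    exact (hww i 1).1.l2Norm_strip_sq_le hη hb0 hbη hQD (hw i).2 (hww i 1).2 (hM1 i) (hM2 i 1)
  have hcorner0 : l2Norm (Ioo (-a) 0 ×ˢ Ioo 0 (ε * g 0)) u ^ 2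
      ≤ K * a * (K * (ε * g 0) * R ^ 2) := by
    have := (hw 0).1.l2Norm_corner_sq_le hη ha0.le haη hSD hu.1 (hw 0).2 hstrip0 (hstrip1 0)
    rwa [← hK] at this
  -- No control of third derivatives is available, so the extra factor `a` is out of reach here; the
  -- strip bound suffices.
  have hcorner1 : ∀ i, l2Norm (Ioo (-a) 0 ×ˢ Ioo 0 (ε * g 0)) (ThinChannel.weakPartial D i u) ^ 2
      ≤ K * (ε * g 0) * R ^ 2 := fun i =>
    (l2Norm_sq_mono hCS ((hw i).2.mono_measure (Measure.restrict_mono hSD le_rfl))).trans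
      (hstrip1 i)
  have hend1 : ∀ i, l2Norm (channelEnd g θ ε) (ThinChannel.weakPartial D i u) ^ 2
      ≤ 2 * (K * (ε * g 0) * R ^ 2) + 2 * a ^ 2 * R ^ 2 := fun i => by
    have h1 := (hww i 0).1.l2Norm_channelEnd_sq_le hg hδ hδ1 hanti hε.le haδ hND (hw i).2
      (hww i 0).2
    have h2 := (l2Norm_sq_mono hND (hww i 0).2).trans (hM2 i 0)
    exact h1.trans (by gcongr; exact hcorner1 i)
  -- The gradient bound for `i = 0` is fed back: it makes the derivative term in the estimate of `u`
  -- of order `a² · a²`.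
  have hneck := (l2Norm_neck_sq_le hε.le ha1 hND (hw 0).2).trans
    (add_le_add (hcorner1 0) (hend1 0))
  have hend0 : l2Norm (channelEnd g θ ε) u ^ 2 ≤ 2 * (K * a * (K * (ε * g 0) * R ^ 2))
      + 2 * a ^ 2 * (K * (ε * g 0) * R ^ 2
        + (2 * (K * (ε * g 0) * R ^ 2) + 2 * a ^ 2 * R ^ 2)) := by
    refine ((hw 0).1.l2Norm_channelEnd_sq_le hg hδ hδ1 hanti hε.le haδ hND hu.1 (hw 0).2).trans ?_
    gcongr
  have ha54 : a ^ 5 ≤ a ^ 4 := pow_le_pow_of_le_one ha0.le ha1 (by norm_num)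
  have ha32 : a ^ 3 ≤ a ^ 2 := pow_le_pow_of_le_one ha0.le ha1 (by norm_num)
  refine ⟨hend0.trans ?_, fun i => (hend1 i).trans ?_⟩
  · calc _ = (2 * K ^ 2 * a + 6 * K * a ^ 2) * (ε * g 0 * R ^ 2) + 4 * R ^ 2 * a ^ 4 := by ring
      _ ≤ (2 * K ^ 2 * a + 6 * K * a ^ 2) * (g 0 * R ^ 2 * a ^ 3) + 4 * R ^ 2 * a ^ 4 := by gcongr
      _ = 2 * K ^ 2 * g 0 * R ^ 2 * a ^ 4 + 6 * K * g 0 * R ^ 2 * a ^ 5 + 4 * R ^ 2 * a ^ 4 := by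
        ring
      _ ≤ 2 * K ^ 2 * g 0 * R ^ 2 * a ^ 4 + 6 * K * g 0 * R ^ 2 * a ^ 4 + 4 * R ^ 2 * a ^ 4 := by
        gcongr
      _ = _ := by ring
  · calc _ = 2 * K * (ε * g 0 * R ^ 2) + 2 * R ^ 2 * a ^ 2 := by ring
      _ ≤ 2 * K * (g 0 * R ^ 2 * a ^ 3) + 2 * R ^ 2 * a ^ 2 := by gcongr
      _ ≤ 2 * K * (g 0 * R ^ 2 * a ^ 2) + 2 * R ^ 2 * a ^ 2 := by gcongr
      _ = _ := by ring

theorem isBigO_of_eventually_sq_le {l : Filter ℝ} {f k : ℝ → ℝ} {C : ℝ}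
    (h : ∀ᶠ ε in l, f ε ^ 2 ≤ C * k ε ^ 2) : f =O[l] k := by
  refine IsBigO.of_bound (Real.sqrt C) (h.mono fun ε hε => ?_)
  rw [Real.norm_eq_abs, Real.norm_eq_abs, ← Real.sqrt_sq_eq_abs, ← Real.sqrt_sq_eq_abs]
  rcases le_or_gt 0 C with hC | hC
  · rw [← Real.sqrt_mul hC]
    exact Real.sqrt_le_sqrt hε
  -- For `C < 0` the hypothesis forces `f ε = 0`, in accordance with `Real.sqrt C = 0`.
  · have h1 : f ε ^ 2 ≤ 0 := hε.trans (mul_nonpos_of_nonpos_of_nonneg hC.le (sq_nonneg _))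
    rw [Real.sqrt_eq_zero_of_nonpos h1]
    positivity

end ThinChannel

end

theorem proposition3p2
    (Ω : Set (ℝ × ℝ)) (hΩ : ThinChannel.IsSmoothBoundedDomain Ω)
    (hseg : ∀ y ∈ Icc (-1 : ℝ) 1, ((0 : ℝ), y) ∈ frontier Ω)
    (hleft : ∀ z ∈ Ω, z.1 < 0)
    (g : ℝ → ℝ) (hg : ContDiffOn ℝ 2 g (Icc 0 1)) (hgpos : ∀ x ∈ Icc (0 : ℝ) 1, 0 < g x)
    (hMP : ThinChannel.ConditionMP g)
    (R ε₀ : ℝ) (hε₀ : 0 < ε₀) (u : ℝ → ℝ × ℝ → ℝ)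
    (hu : ∀ ε ∈ Ioo 0 ε₀, ThinChannel.MemH2 (ThinChannel.dumbbell Ω g ε) (u ε) ∧
      ThinChannel.h2Norm (ThinChannel.dumbbell Ω g ε) (u ε) ≤ R)
    (θ : ℝ) (hθ : 0 < θ) (hθ' : θ < 1 / 3) :
    (fun ε : ℝ => ThinChannel.l2Norm (ThinChannel.channelEnd g θ ε) (u ε))
        =O[𝓝[>] 0] (fun ε : ℝ => ε ^ (2 * θ)) ∧
      (fun ε : ℝ => ThinChannel.gradL2Norm (ThinChannel.dumbbell Ω g ε)
          (ThinChannel.channelEnd g θ ε) (u ε))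
        =O[𝓝[>] 0] (fun ε : ℝ => ε ^ θ) := by

  obtain ⟨δ, hδ, hδ2, hanti⟩ := hMP
  obtain ⟨η, hη, hrect⟩ := ThinChannel.exists_rectangle_subset hΩ hseg hleft
  have hg0 : 0 < g 0 := hgpos 0 (by simp)
  have htend : Tendsto (fun ε : ℝ => ε ^ θ) (𝓝[>] 0) (𝓝 0) := by
    have : ContinuousAt (fun ε : ℝ => ε ^ θ) 0 := Real.continuousAt_rpow_const 0 θ (Or.inr hθ.le)
    simpa [ContinuousAt, Real.zero_rpow hθ.ne'] using this.tendsto.mono_left nhdsWithin_le_nhds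
  have hid : Tendsto (fun ε : ℝ => ε * g 0) (𝓝[>] 0) (𝓝 0) := by
    have : Tendsto (fun ε : ℝ => ε * g 0) (𝓝 0) (𝓝 (0 * g 0)) := tendsto_id.mul_const _
    rw [zero_mul] at this
    exact this.mono_left nhdsWithin_le_nhds
  have hev : ∀ᶠ ε in 𝓝[>] (0 : ℝ), 0 < ε ∧ ε < ε₀ ∧ ε ^ θ ≤ δ ∧ ε ^ θ ≤ η / 2 ∧ ε * g 0 ≤ η / 2 ∧
      ε ≤ (ε ^ θ) ^ 3 := by
    filter_upwards [Ioo_mem_nhdsGT hε₀, Ioo_mem_nhdsGT one_pos, htend.eventually_le_const hδ,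
      htend.eventually_le_const (half_pos hη), hid.eventually_le_const (half_pos hη)]
      with ε h1 h2 h3 h4 h5
    refine ⟨h1.1, h1.2, h3, h4, h5, ?_⟩
    rw [← Real.rpow_natCast, ← Real.rpow_mul h1.1.le]
    calc ε = ε ^ (1 : ℝ) := (Real.rpow_one ε).symm
      -- Here `θ < 1/3` enters: `3θ ≤ 1` and `ε < 1`.
      _ ≤ _ := Real.rpow_le_rpow_of_exponent_ge h1.1 h2.2.le (by push_cast; linarith)
  -- The constants, found by unification, depend only on `g 0`, `η` and `R`, hence are uniform in
  -- `ε`.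
  obtain ⟨C₀, C₁, hbounds⟩ : ∃ C₀ C₁ : ℝ, ∀ᶠ ε in 𝓝[>] (0 : ℝ),
      ThinChannel.l2Norm (ThinChannel.channelEnd g θ ε) (u ε) ^ 2 ≤ C₀ * (ε ^ θ) ^ 4 ∧
      ∀ i, ThinChannel.l2Norm (ThinChannel.channelEnd g θ ε)
        (ThinChannel.weakPartial (ThinChannel.dumbbell Ω g ε) i (u ε)) ^ 2
          ≤ C₁ * (ε ^ θ) ^ 2 := ⟨_, _, hev.mono fun ε h => ThinChannel.MemH2.channelEnd_bounds hΩ.isOpen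
    hg.continuousOn hg0 hδ (by linarith) hanti hη hrect h.1 h.2.2.1 h.2.2.2.1 h.2.2.2.2.1
    h.2.2.2.2.2 (hu ε ⟨h.1, h.2.1⟩).1 (hu ε ⟨h.1, h.2.1⟩).2 rfl⟩
  constructor
  · refine ThinChannel.isBigO_of_eventually_sq_le (C := C₀) ?_
    filter_upwards [hbounds, hev] with ε hb he
    have : ε ^ (2 * θ) = (ε ^ θ) ^ 2 := by
      rw [← Real.rpow_natCast, ← Real.rpow_mul he.1.le, mul_comm]; norm_num
    rw [this, ← pow_mul]
    exact hb.1
  · refine ThinChannel.isBigO_of_eventually_sq_le (C := Fintype.card (Fin 2) * C₁) ?_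
    filter_upwards [hbounds] with ε hb
    rw [ThinChannel.gradL2Norm, Real.sq_sqrt (Finset.sum_nonneg fun _ _ => sq_nonneg _)]
    refine (Finset.sum_le_sum fun i _ => hb.2 i).trans_eq ?_
    rw [Finset.sum_const, Finset.card_univ, nsmul_eq_mul, ← mul_assoc]
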